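/- Let $N$ be a finite non-empty set of agents and $X$ a finite set of alternatives. A preference is a complete, antisymmetric and transitive binary relation $R_i$ on $X$, with strict part $P_i$. Each agent $i\in N$ has a set $\mathcal R_i$ of admissible preferences on $X$; these sets may differ across agents. Put $S(\mathcal R_i)=\{(x,y)\in X^2 : x\neq y \text{ and } x\,P_i\,y \text{ for all } R_i\in\mathcal R_i\}$. The domain $\mathcal R_i$ is called non-conditional if, for every preference $R_i$ on $X$, one has $R_i\in\mathcal R_i$ if and only if $x\,P_i\,y$ for all $(x,y)\in S(\mathcal R_i)$. A social choice rule is a function $f:\prod_{i\in N}\mathcal R_i\to X$, and $r(f)\subseteq X$ denotes its range. The rule $f$ is strategy-proof if there are no agent $i$, profile $R$ and $R_i'\in\mathcal R_i$ with $f(R_i',R_{-i})\,P_i\,f(R)$. It is a dictatorship of agent $i$ if $f(R)\,R_i\,x$ for all profiles $R$ and all $x\in r(f)$, and it is non-dictatorial if it is a dictatorship of no agent. Theorem. Suppose that $\mathcal R_i$ is non-conditional for every $i\in N$. Then there is no social choice rule $f:\prod_{i\in N}\mathcal R_i\to X$ with $|r(f)|\neq 2$ that is both strategy-proof and non-dictatorial.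 -/

import Mathlib

/-- A strict preference on `X`: a complete, antisymmetric and transitive relation;
`R.weak x y` reads "`x` is at least as good as `y`". -/
@[ext]
structure Preference (X : Type*) where
  weak : X → X → Prop
  complete : ∀ x y, weak x y ∨ weak y x
  antisymm : ∀ x y, weak x y → weak y x → x = y
  trans : ∀ x y z, weak x y → weak y z → weak x z

namespace Preference

/-- The strict part of a preference: `R.strict x y` reads "`x` is preferred to `y`". -/
def strict {X : Type*} (R : Preference X) (x y : X) : Prop :=
  R.weak x y ∧ ¬ R.weak y x

end Preference

/-- The ordered pairs of distinct alternatives on whose ranking all preferences in `D` agree. -/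
def fixedPairs {X : Type*} (D : Set (Preference X)) : Set (X × X) :=
  {p | p.1 ≠ p.2 ∧ ∀ R ∈ D, R.strict p.1 p.2}

/-- A preference domain is non-conditional if it consists exactly of the preferences that respect
all its fixed pairs. -/
def NonConditional {X : Type*} (D : Set (Preference X)) : Prop :=
  ∀ R : Preference X, R ∈ D ↔ ∀ p ∈ fixedPairs D, R.strict p.1 p.2

/-- Preference profiles: one admissible preference for each agent. -/
abbrev Profile {N X : Type*} (D : N → Set (Preference X)) : Type _ :=
  (i : N) → D i

/-- A social choice rule selects an alternative for each admissible profile. -/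
abbrev SocialChoiceRule {N X : Type*} (D : N → Set (Preference X)) : Type _ :=
  Profile D → X

namespace SocialChoiceRule

variable {N X : Type*} {D : N → Set (Preference X)}

/-- The set of alternatives selected by the rule at some admissible profile. -/
def range (f : SocialChoiceRule D) : Set X :=
  Set.range f

/-- At some profile `R`, agent `i` obtains a preferred alternative by reporting some other
admissible preference `R'`. -/
def ManipulableBy [DecidableEq N] (f : SocialChoiceRule D) (i : N) : Prop :=
  ∃ (R : Profile D) (R' : D i), (R i).1.strict (f (Function.update R i R')) (f R)

def StrategyProof [DecidableEq N] (f : SocialChoiceRule D) : Prop :=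
  ∀ i : N, ¬ f.ManipulableBy i

/-- The rule always selects the best alternative of agent `i` within the range. -/
def DictatorshipOf (f : SocialChoiceRule D) (i : N) : Prop :=
  ∀ R : Profile D, ∀ x ∈ f.range, (R i).1.weak (f R) x

def NonDictatorial (f : SocialChoiceRule D) : Prop :=
  ¬ ∃ i : N, f.DictatorshipOf i

end SocialChoiceRule

/-! A non-conditional domain is connected by swaps of neighbours, and in each of its preferences any
set that is upward closed for the fixed pairs can be moved to the top. By strategy-proofness, one
agent's swap of `p` and `q` changes nothing or turns the outcome `p` into `q`.

Induct on the number of agents with several admissible preferences. If a report `S` of such an agent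
`j` leaves at least three outcomes, freezing `j` at `S` produces a dictator, and swaps carry this
dictatorship to all reports of `j` (`eq_of_isSwap_of_dictator`, `dictator_of_fix`).

Otherwise each of their reports leaves at most two outcomes. Without a dictator,
`outcomes_subset_of_isSwap` gives each of them a report that enforces a common outcome `b`.
Efficiency (`pareto`) then contradicts the existence of two further outcomes. -/

open Function

/-! ### Linear orders: lifting a set, swapping neighbours -/

namespace Preference

variable {X : Type*}

theorem weak_refl (R : Preference X) (x : X) : R.weak x x :=
  (R.complete x x).elim id id

theorem strict.ne {R : Preference X} {x y : X} (h : R.strict x y) : x ≠ y := by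
  rintro rfl
  exact h.2 h.1

theorem strict.trans {R : Preference X} {x y z : X} (h : R.strict x y) (h' : R.strict y z) :
    R.strict x z :=
  ⟨R.trans _ _ _ h.1 h'.1, fun hzx => h'.2 (R.trans _ _ _ hzx h.1)⟩

theorem strict_of_weak {R : Preference X} {x y : X} (h : R.weak x y) (hne : x ≠ y) :
    R.strict x y :=
  ⟨h, fun h' => hne (R.antisymm _ _ h h')⟩

theorem weak_of_not_strict {R : Preference X} {x y : X} (h : ¬ R.strict y x) : R.weak x y := by
  by_contra hn
  exact h ⟨(R.complete x y).resolve_left hn, hn⟩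

theorem strict_or_strict (R : Preference X) {x y : X} (h : x ≠ y) :
    R.strict x y ∨ R.strict y x :=
  (R.complete x y).imp (strict_of_weak · h) (strict_of_weak · h.symm)

theorem ext_of_strict {R S : Preference X} (h : ∀ x y, R.strict x y → S.strict x y) : R = S := by
  ext x y
  refine ⟨fun hR => ?_, fun hS => weak_of_not_strict fun hR => (h _ _ hR).2 hS⟩
  by_cases hxy : x = y
  · exact hxy ▸ S.weak_refl x
  · exact (h _ _ (strict_of_weak hR hxy)).1

/-- Move the alternatives of `U` above all others, keeping the order inside `U` and outside. -/
def lift (R : Preference X) (U : Set X) : Preference X where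
  weak x y := (x ∈ U ∧ y ∉ U) ∨ ((x ∈ U ↔ y ∈ U) ∧ R.weak x y)
  complete x y := by
    have := R.complete x y
    tauto
  antisymm x y h h' := by
    have := R.antisymm x y
    tauto
  trans x y z h h' := by
    have := R.trans x y z
    tauto

theorem lift_strict_of_mem {R : Preference X} {U : Set X} {x y : X} (hx : x ∈ U) (hy : y ∉ U) :
    (R.lift U).strict x y := by
  simp only [strict, lift]
  tauto

theorem lift_strict_of_strict {R : Preference X} {U : Set X} {x y : X} (h : R.strict x y)
    (hU : y ∈ U → x ∈ U) : (R.lift U).strict x y := by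
  simp only [strict, lift] at *
  tauto

theorem lift_weak_of_weak {R : Preference X} {U : Set X} {x y : X} (h : R.weak x y)
    (hU : y ∈ U → x ∈ U) : (R.lift U).weak x y := by
  simp only [lift] at *
  tauto

/-- `S` arises from `R` by exchanging the neighbours `p` and `q`, where `R` prefers `p`. -/
structure IsSwap (R S : Preference X) (p q : X) : Prop where
  left : R.strict p q
  right : S.strict q p
  eq_of_reversed : ∀ x y, R.strict x y → S.strict y x → x = p ∧ y = q

/-- Exchange two alternatives without any alternative between them. -/
def swap (R : Preference X) (p q : X) (hpq : R.strict p q)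
    (hadj : ∀ w, R.strict p w → ¬ R.strict w q) : Preference X where
  weak x y := (x = q ∧ y = p) ∨ (R.weak x y ∧ ¬ (x = p ∧ y = q))
  complete x y := by
    have := R.complete x y
    have := hpq.ne
    by_cases h1 : x = p <;> by_cases h2 : y = q <;> by_cases h3 : x = q <;>
      by_cases h4 : y = p <;> simp_all
  antisymm x y h h' := by
    rcases h with ⟨rfl, rfl⟩ | ⟨h, hn⟩
    · rcases h' with ⟨rfl, h2⟩ | ⟨_, hn'⟩
      · rfl
      · exact absurd ⟨rfl, rfl⟩ hn'
    · rcases h' with ⟨rfl, rfl⟩ | ⟨h', _⟩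
      · exact absurd ⟨rfl, rfl⟩ hn
      · exact R.antisymm _ _ h h'
  trans x y z h h' := by
    rcases h with ⟨rfl, rfl⟩ | ⟨h, hn⟩
    · rcases h' with ⟨h1, h2⟩ | ⟨h', hn'⟩
      · exact absurd h1 hpq.ne
      · by_cases hz : y = z
        · exact Or.inl ⟨rfl, hz.symm⟩
        · right
          refine ⟨?_, fun h => hpq.ne h.1.symm⟩
          by_contra hw
          have hzx : z ≠ x := fun e => hn' ⟨rfl, e⟩
          exact hadj z (strict_of_weak h' hz) ⟨(R.complete _ _).resolve_left hw, hw⟩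
    · rcases h' with ⟨rfl, rfl⟩ | ⟨h', hn'⟩
      · by_cases hx : x = y
        · exact Or.inl ⟨by simp_all, by simp_all⟩
        · by_cases hx2 : x = z
          · exact absurd ⟨hx2, rfl⟩ hn
          · right
            refine ⟨?_, fun h => hpq.ne h.2⟩
            by_contra hw
            exact hadj x ⟨(R.complete _ _).resolve_left hw, hw⟩ (strict_of_weak h hx)
      · by_cases hc : x = p ∧ z = q
        · obtain ⟨rfl, rfl⟩ := hc
          have hxy : x ≠ y := fun e => hn' ⟨e.symm, rfl⟩
          have hyz : y ≠ z := fun e => hn ⟨rfl, e⟩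
          exact absurd (strict_of_weak h' hyz) (hadj y (strict_of_weak h hxy))
        · exact Or.inr ⟨R.trans _ _ _ h h', hc⟩

theorem swap_strict_iff {R : Preference X} {p q : X} (hpq : R.strict p q)
    (hadj : ∀ w, R.strict p w → ¬ R.strict w q) {x y : X} :
    (R.swap p q hpq hadj).strict x y ↔
      (x = q ∧ y = p) ∨ (R.strict x y ∧ ¬ (x = p ∧ y = q)) := by
  have h1 := hpq.1
  have h2 := hpq.2
  have h3 := hpq.ne
  simp only [strict, swap]
  by_cases hx : x = p <;> by_cases hy : y = q <;> by_cases hx' : x = q <;>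
    by_cases hy' : y = p <;> simp_all

theorem isSwap_swap {R : Preference X} {p q : X} (hpq : R.strict p q)
    (hadj : ∀ w, R.strict p w → ¬ R.strict w q) : IsSwap R (R.swap p q hpq hadj) p q where
  left := hpq
  right := (swap_strict_iff hpq hadj).2 (Or.inl ⟨rfl, rfl⟩)
  eq_of_reversed x y h h' := by
    rcases (swap_strict_iff hpq hadj).1 h' with ⟨rfl, rfl⟩ | ⟨h', _⟩
    · exact ⟨rfl, rfl⟩
    · exact absurd h'.1 h.2

/-- The pairs on which two preferences disagree. -/
def inversions (R S : Preference X) : Set (X × X) :=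
  {p | R.strict p.1 p.2 ∧ S.strict p.2 p.1}

/-- Take an inversion with the fewest alternatives between its members in `R`. An alternative `w`
between `p` and `q` would make `(p, w)` or `(w, q)` a tighter inversion. -/
theorem exists_adjacent_inversion [Finite X] {R S : Preference X} (h : R ≠ S) :
    ∃ p q, R.strict p q ∧ S.strict q p ∧ ∀ w, R.strict p w → ¬ R.strict w q := by
  classical
  have hne : (inversions R S).Nonempty := by
    by_contra hn
    refine h (ext_of_strict fun x y hxy => ?_)
    refine (S.strict_or_strict hxy.ne).resolve_right fun hyx => hn ⟨(x, y), hxy, hyx⟩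
  obtain ⟨⟨p, q⟩, ⟨hpq, hqp⟩, hmin⟩ := (Set.toFinite (inversions R S)).exists_minimalFor
    (fun a => {w | R.strict a.1 w ∧ R.strict w a.2}.ncard) _ hne
  have key : ∀ a ∈ inversions R S, ∀ w, R.strict p w → R.strict w q →
      {v | R.strict a.1 v ∧ R.strict v a.2} ⊆ {v | R.strict p v ∧ R.strict v q} →
      ¬ (R.strict a.1 w ∧ R.strict w a.2) → False := by
    intro a ha w h1 h2 hsub hw
    have hlt := Set.ncard_lt_ncard (hsub.ssubset_of_mem_notMem (a := w) ⟨h1, h2⟩ hw)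
      (Set.toFinite _)
    have hle : _ ≤ _ := hmin ha hlt.le
    exact absurd hlt (not_lt.2 hle)
  refine ⟨p, q, hpq, hqp, fun w h1 h2 => ?_⟩
  rcases S.strict_or_strict h1.ne with hs | hs
  · rcases S.strict_or_strict h2.ne with hs' | hs'
    · exact hqp.2 (hs.trans hs').1
    · exact key (w, q) ⟨h2, hs'⟩ w h1 h2 (fun v hv => ⟨h1.trans hv.1, hv.2⟩)
        fun hw => hw.1.ne rfl
  · exact key (p, w) ⟨h1, hs⟩ w h1 h2 (fun v hv => ⟨hv.1, hv.2.trans h2⟩)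
      fun hw => hw.2.ne rfl

end Preference

/-! ### Closure properties of non-conditional domains -/

namespace NonConditional

open Preference

variable {X : Type*} {D : Set (Preference X)}

/-- Freezing the report of an agent thus stays within the class of non-conditional domains. -/
theorem singleton (S : Preference X) : NonConditional {S} := by
  intro R
  constructor
  · rintro rfl p hp
    exact hp.2 R rfl
  · intro h
    exact (ext_of_strict fun x y hxy =>
      h (x, y) ⟨hxy.ne, fun T hT => by rw [hT]; exact hxy⟩).symm

/-- Any two preferences of a non-conditional domain are connected by swaps within the domain. -/
theorem swap_induction [Finite X] (hD : NonConditional D) {P : Preference X → Prop}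
    (step : ∀ R ∈ D, ∀ S ∈ D, ∀ p q, IsSwap R S p q → P R → P S) {R S : Preference X}
    (hR : R ∈ D) (hS : S ∈ D) (h : P R) : P S := by
  induction hn : (inversions R S).ncard using Nat.strong_induction_on generalizing R with
  | _ n ih =>
    by_cases hRS : R = S
    · exact hRS ▸ h
    obtain ⟨p, q, hpq, hqp, hadj⟩ := exists_adjacent_inversion hRS
    -- `R` and `S` disagree on `p` and `q`, so the swap breaks no fixed pair.
    have hmem : R.swap p q hpq hadj ∈ D := by
      rw [hD]
      intro a ha
      refine (swap_strict_iff hpq hadj).2 (Or.inr ⟨ha.2 R hR, ?_⟩)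
      rintro ⟨h1, h2⟩
      have := ha.2 S hS
      rw [h1, h2] at this
      exact this.2 hqp.1
    refine ih _ ?_ hmem (step R hR _ hmem p q (isSwap_swap hpq hadj) h) rfl
    rw [← hn]
    refine Set.ncard_lt_ncard (Set.ssubset_iff_of_subset ?_ |>.2 ⟨(p, q), ⟨hpq, hqp⟩, ?_⟩)
      (Set.toFinite _)
    · rintro ⟨x, y⟩ ⟨h1, h2⟩
      rcases (swap_strict_iff hpq hadj).1 h1 with ⟨h3, h4⟩ | h3
      · dsimp only at h2 h3 h4
        rw [h3, h4] at h2
        exact absurd h2.1 hqp.2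
      · exact ⟨h3.1, h2⟩
    · rintro ⟨h1, -⟩
      rcases (swap_strict_iff hpq hadj).1 h1 with h3 | h3
      · exact hpq.ne h3.1
      · exact h3.2 ⟨rfl, rfl⟩

theorem lift_mem (hD : NonConditional D) {R : Preference X} (hR : R ∈ D) {U : Set X}
    (hU : ∀ x y, (x, y) ∈ fixedPairs D → y ∈ U → x ∈ U) : R.lift U ∈ D := by
  rw [hD]
  exact fun a ha => lift_strict_of_strict (ha.2 R hR) (hU _ _ ha)

end NonConditional

/-- The alternatives which are at least as good as `x` for all preferences in the domain. -/
def upperFixed {X : Type*} (D : Set (Preference X)) (x : X) : Set X :=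
  {z | z = x ∨ (z, x) ∈ fixedPairs D}

section UpperFixed

open Preference

variable {X : Type*} {D : Set (Preference X)} {R : Preference X}

theorem weak_of_mem_upperFixed (hR : R ∈ D) {x z : X} (h : z ∈ upperFixed D x) :
    R.weak z x := by
  rcases h with rfl | h
  · exact R.weak_refl _
  · exact (h.2 R hR).1

theorem notMem_upperFixed (hR : R ∈ D) {x z : X} (h : R.strict x z) : z ∉ upperFixed D x :=
  fun h' => h.2 (weak_of_mem_upperFixed hR h')

theorem mem_upperFixed_trans (hR : R ∈ D) {x y z : X} (h : (x, y) ∈ fixedPairs D)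
    (h' : y ∈ upperFixed D z) : x ∈ upperFixed D z := by
  rcases h' with rfl | h'
  · exact Or.inr h
  · exact Or.inr ⟨((h.2 R hR).trans (h'.2 R hR)).ne, fun S hS => (h.2 S hS).trans (h'.2 S hS)⟩

/-- Move `x` up as far as the domain allows. -/
def Preference.raise (R : Preference X) (D : Set (Preference X)) (x : X) : Preference X :=
  R.lift (upperFixed D x)

theorem NonConditional.raise_mem (hD : NonConditional D) (hR : R ∈ D) (x : X) :
    R.raise D x ∈ D :=
  hD.lift_mem hR fun _ _ => mem_upperFixed_trans hR

theorem raise_strict {x z : X} (h : z ∉ upperFixed D x) : (R.raise D x).strict x z :=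
  lift_strict_of_mem (Or.inl rfl) h

theorem raise_strict_of_strict {x y z : X} (h : R.strict y z) (hz : z ∉ upperFixed D x) :
    (R.raise D x).strict y z :=
  lift_strict_of_strict h fun h => absurd h hz

end UpperFixed

/-! ### Strategy-proof rules: monotonicity and efficiency -/

section Rules

open Preference

variable {N X : Type*}

/-- The profiles all of whose preferences are admissible. -/
def admissible (D : N → Set (Preference X)) : Set (N → Preference X) :=
  {R | ∀ i, R i ∈ D i}

/-- No agent gains by a misreport at an admissible profile. -/
def TruthfulOn [DecidableEq N] (F : (N → Preference X) → X) (D : N → Set (Preference X)) : Prop :=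
  ∀ R ∈ admissible D, ∀ i, ∀ Q ∈ D i, (R i).weak (F R) (F (update R i Q))

/-- A set is large if it has at least three elements. -/
def IsLarge (A : Set X) : Prop :=
  ∀ p q, ∃ r ∈ A, r ≠ p ∧ r ≠ q

/-- The outcomes that remain possible once agent `j` reports `S`. -/
def outcomes (F : (N → Preference X) → X) (D : N → Set (Preference X)) (j : N)
    (S : Preference X) : Set X :=
  F '' {R | R ∈ admissible D ∧ R j = S}

variable [DecidableEq N] {F : (N → Preference X) → X} {D : N → Set (Preference X)}

theorem update_mem_admissible {R : N → Preference X} (hR : R ∈ admissible D) {i : N}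
    {Q : Preference X} (hQ : Q ∈ D i) : update R i Q ∈ admissible D := by
  intro k
  by_cases h : k = i
  · subst h
    simpa using hQ
  · simpa [h] using hR k

theorem update_mem_outcomes {R : N → Preference X} (hR : R ∈ admissible D) {i : N}
    {Q : Preference X} (hQ : Q ∈ D i) : F (update R i Q) ∈ outcomes F D i Q :=
  ⟨_, ⟨update_mem_admissible hR hQ, by simp⟩, rfl⟩

theorem update_eq_of_apply_eq {R : N → Preference X} {i : N} {Q : Preference X} (h : R i = Q) :
    update R i Q = R := by
  rw [← h, update_eq_self]

/-- Change one profile into another agent by agent. -/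
theorem profile_induction [Finite N] {P : (N → Preference X) → Prop} {R R' : N → Preference X}
    (hR : R ∈ admissible D) (hR' : R' ∈ admissible D) (h : P R)
    (step : ∀ Q ∈ admissible D, ∀ j, Q j = R j → P Q → P (update Q j (R' j))) : P R' := by
  have := Fintype.ofFinite N
  have key : ∀ s : Finset N, s.piecewise R' R ∈ admissible D ∧ P (s.piecewise R' R) := by
    intro s
    induction s using Finset.induction_on with
    | empty => simpa using ⟨hR, h⟩
    | insert j s hj ih =>
      rw [Finset.piecewise_insert]
      exact ⟨update_mem_admissible ih.1 (hR' j), step _ ih.1 j (by simp [hj]) ih.2⟩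
  simpa using (key Finset.univ).2

theorem admissible_fix {R : N → Preference X} {j : N} {S : Preference X} (hS : S ∈ D j) :
    R ∈ admissible (update D j {S}) ↔ R ∈ admissible D ∧ R j = S := by
  constructor
  · intro h
    have hj : R j = S := by simpa using h j
    refine ⟨fun k => ?_, hj⟩
    by_cases hk : k = j
    · subst hk
      rwa [hj]
    · simpa [hk] using h k
  · rintro ⟨h, rfl⟩ k
    by_cases hk : k = j
    · subst hk
      simp
    · simpa [hk] using h k

/-- Since `F` is defined on all profiles, shrinking the domain leaves the rule itself unchanged, as
the induction needs. -/
theorem TruthfulOn.fix (hF : TruthfulOn F D) {j : N} {S : Preference X} (hS : S ∈ D j) :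
    TruthfulOn F (update D j {S}) := by
  intro R hR i Q hQ
  refine hF R ((admissible_fix hS).1 hR).1 i Q ?_
  by_cases hi : i = j
  · subst hi
    have : Q = S := by simpa using hQ
    rwa [this]
  · simpa [hi] using hQ

/-- Maskin monotonicity. When one agent changes reports, the old one ranks the old outcome above the
new one, hence so does the new report; truthfulness at the new report gives the converse. -/
theorem TruthfulOn.monotone [Finite N] (hF : TruthfulOn F D) {R R' : N → Preference X}
    (hR : R ∈ admissible D) (hR' : R' ∈ admissible D)
    (h : ∀ j z, (R j).weak (F R) z → (R' j).weak (F R) z) : F R' = F R := by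
  refine profile_induction (P := fun Q => F Q = F R) hR hR' rfl fun Q hQ j hj hQR => ?_
  have h1 := hF Q hQ j _ (hR' j)
  have h2 := hF _ (update_mem_admissible hQ (hR' j)) j _ (hQ j)
  rw [update_idem, update_eq_self, update_self] at h2
  rw [hj, hQR] at h1
  rw [hQR] at h2
  exact (R' j).antisymm _ _ h2 (h j _ h1)

/-- The rule is efficient relative to the attained outcomes. -/
theorem TruthfulOn.pareto [Finite N] (hF : TruthfulOn F D) (hD : ∀ i, NonConditional (D i))
    {R : N → Preference X} (hR : R ∈ admissible D) {x y : X} (hx : x ∈ F '' admissible D)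
    (hxy : x ≠ y) (h : ∀ j, (D j).Nontrivial → (R j).strict x y) : F R ≠ y := by
  rintro hy
  obtain ⟨R', hR', rfl⟩ := hx
  -- Raising `F R'` in every report of `R` lets monotonicity apply both from `R` and from `R'`,
  -- which forces two different outcomes.
  have hQ : (fun j => (R j).raise (D j) (F R')) ∈ admissible D :=
    fun j => (hD j).raise_mem (hR j) _
  have h1 : F (fun j => (R j).raise (D j) (F R')) = F R := by
    refine hF.monotone hR hQ fun j z hz => ?_
    by_cases hj : (D j).Nontrivial
    · have hs := h j hj
      rw [← hy] at hs
      refine lift_weak_of_weak hz fun hzU => ?_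
      exact absurd ((R j).trans _ _ _ hz (weak_of_mem_upperFixed (hR j) hzU)) hs.2
    · have hQj := Set.not_nontrivial_iff.1 hj (hQ j) (hR j)
      dsimp only at hQj ⊢
      rwa [hQj]
  have h2 : F (fun j => (R j).raise (D j) (F R')) = F R' := by
    refine hF.monotone hR' hQ fun j z hz => ?_
    by_cases hzx : z = F R'
    · rw [hzx]
      exact weak_refl _ _
    · exact (raise_strict (notMem_upperFixed (hR' j) (strict_of_weak hz (Ne.symm hzx)))).1
  exact hxy (h2.symm.trans (h1.trans hy))

/-- Exchanging two neighbours in the report of an agent changes nothing or turns the outcome from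
the one into the other. -/
theorem TruthfulOn.eq_or_of_isSwap (hF : TruthfulOn F D) {R : N → Preference X}
    (hR : R ∈ admissible D) {j : N} {S S' : Preference X} (hS : S ∈ D j) (hS' : S' ∈ D j)
    {p q : X} (h : IsSwap S S' p q) :
    F (update R j S') = F (update R j S) ∨ (F (update R j S) = p ∧ F (update R j S') = q) := by
  by_cases he : F (update R j S') = F (update R j S)
  · exact Or.inl he
  have h1 := hF _ (update_mem_admissible hR hS) j _ hS'
  have h2 := hF _ (update_mem_admissible hR hS') j _ hS
  rw [update_idem, update_self] at h1 h2
  exact Or.inr (h.eq_of_reversed _ _ (strict_of_weak h1 (Ne.symm he)) (strict_of_weak h2 he))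

/-- An outcome that agent `i` can attain against fixed reports of the others is not better than
the outcome of truth-telling. -/
theorem TruthfulOn.weak_update (hF : TruthfulOn F D) {R : N → Preference X}
    (hR : R ∈ admissible D) {i : N} {Q Q' : Preference X} (hQ : Q ∈ D i) (hQ' : Q' ∈ D i) :
    Q.weak (F (update R i Q)) (F (update R i Q')) := by
  have := hF _ (update_mem_admissible hR hQ) i _ hQ'
  rwa [update_idem, update_self] at this

/-! ### Extending a dictatorship from one report to all -/

/-- If the swap turned `p` into `q`, a third attainable outcome `r` would let agent `i` manipulate
against `S'`: `i` still obtains `r` by ranking it best among the attainable outcomes. -/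
theorem TruthfulOn.eq_of_isSwap_of_dictator (hF : TruthfulOn F D)
    (hD : ∀ i, NonConditional (D i)) {i j : N} {S S' : Preference X} (hS : S ∈ D j)
    (hS' : S' ∈ D j) {p q : X} (h : IsSwap S S' p q) (hB : IsLarge (outcomes F D j S))
    (hi : ∀ R ∈ admissible D, R j = S → ∀ x ∈ outcomes F D j S, (R i).weak (F R) x)
    {R : N → Preference X} (hR : R ∈ admissible D) :
    F (update R j S') = F (update R j S) := by
  have hij : i ≠ j := by
    rintro rfl
    obtain ⟨a, ⟨Ra, ⟨hRa, hRaS⟩, rfl⟩, -, -⟩ := hB p p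
    obtain ⟨b, ⟨Rb, ⟨hRb, hRbS⟩, rfl⟩, hb, -⟩ := hB (F Ra) (F Ra)
    refine hb (S.antisymm _ _ ?_ ?_)
    · have := hi Rb hRb hRbS _ ⟨Ra, ⟨hRa, hRaS⟩, rfl⟩
      rwa [hRbS] at this
    · have := hi Ra hRa hRaS _ ⟨Rb, ⟨hRb, hRbS⟩, rfl⟩
      rwa [hRaS] at this
  have anti : ∀ b ∈ outcomes F D j S, ∀ c ∈ outcomes F D j S, c ∈ upperFixed (D i) b → c = b := by
    rintro b ⟨Rb, ⟨hRb, hRbS⟩, rfl⟩ c hc hcb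
    exact (Rb i).antisymm _ _ (weak_of_mem_upperFixed (hRb i) hcb) (hi Rb hRb hRbS c hc)
  -- agent `i` obtains any best attainable outcome while agent `j` reports `S`
  have best : ∀ M ∈ D i, ∀ b ∈ outcomes F D j S, (∀ c ∈ outcomes F D j S, M.weak b c) →
      F (update (update R i M) j S) = b := by
    intro M hM b hb hbest
    have hadm := update_mem_admissible (update_mem_admissible hR hM) hS
    have h1 := hi _ hadm (by simp) b hb
    rw [update_of_ne hij, update_self] at h1
    exact M.antisymm _ _ h1 (hbest _ (update_mem_outcomes (update_mem_admissible hR hM) hS))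
  have swap := fun M (hM : M ∈ D i) =>
    hF.eq_or_of_isSwap (update_mem_admissible hR hM) hS hS' h
  have truth : ∀ M ∈ D i, ∀ M' ∈ D i,
      M.weak (F (update (update R i M) j S')) (F (update (update R i M') j S')) := by
    intro M hM M' hM'
    rw [update_comm hij, update_comm hij]
    exact hF.weak_update (update_mem_admissible hR hS') hM hM'
  by_contra hne
  obtain ⟨hp, hq⟩ := (hF.eq_or_of_isSwap hR hS hS' h).resolve_left hne
  have hpB : p ∈ outcomes F D j S := hp ▸ update_mem_outcomes hR hS
  have hqi : F (update (update R i (R i)) j S') = q := by rwa [update_eq_self]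
  have hptop : ∀ c ∈ outcomes F D j S, (R i).weak p c := by
    intro c hc
    have := hi _ (update_mem_admissible hR hS) (by simp) c hc
    rwa [update_of_ne hij, hp] at this
  obtain ⟨r, hrB, hrp, hrq⟩ := hB p q
  have raise_best : ∀ M ∈ D i, ∀ b ∈ outcomes F D j S, ∀ c ∈ outcomes F D j S,
      (M.raise (D i) b).weak b c := by
    intro M hM b hb c hc
    by_cases hcb : c ∈ upperFixed (D i) b
    · rw [anti b hb c hc hcb]
      exact weak_refl _ _
    · exact (raise_strict hcb).1
  have stays : ∀ M ∈ D i, (∀ c ∈ outcomes F D j S, M.weak r c) →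
      F (update (update R i M) j S') = r := by
    intro M hM hMr
    have h1 := best M hM r hrB hMr
    rcases swap M hM with h2 | h2
    · exact h2.trans h1
    · exact absurd (h1.symm.trans h2.1) hrp
  have hr := stays _ ((hD i).raise_mem (hR i) r) (raise_best _ (hR i) r hrB)
  have hqr : (R i).strict q r := by
    refine strict_of_weak ?_ (Ne.symm hrq)
    have := truth _ (hR i) _ ((hD i).raise_mem (hR i) r)
    rwa [hqi, hr] at this
  -- if nothing attainable is above `q` for sure, then `q` can be placed just above `r`
  have noUpper : ¬ ∀ b ∈ outcomes F D j S, b ∉ upperFixed (D i) q := by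
    intro hno
    -- Here `r` is best in the outcome set and so is obtained, yet `q` ranks higher and is available
    -- by reporting `R i`.
    have hM : ((R i).raise (D i) r).raise (D i) q ∈ D i :=
      (hD i).raise_mem ((hD i).raise_mem (hR i) r) q
    have h1 := stays _ hM fun c hc => by
      by_cases hcr : c = r
      · rw [hcr]
        exact weak_refl _ _
      · exact (raise_strict_of_strict (raise_strict fun hc' => hcr (anti r hrB c hc hc'))
          (hno c hc)).1
    have h2 := truth _ hM _ (hR i)
    rw [h1, hqi] at h2
    exact (raise_strict (notMem_upperFixed (hR i) hqr)).2 h2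
  rcases (R i).strict_or_strict h.left.ne with hpq | hqp
  · by_cases hqr' : q ∈ upperFixed (D i) r
    · refine noUpper fun b hb hbq => ?_
      rcases hqr' with hqr' | hqr'
      · exact hqr.ne hqr'
      have hbr : b = r := by
        rcases hbq with rfl | hbq
        · exact anti r hrB b hb (Or.inr hqr')
        · exact anti r hrB b hb (mem_upperFixed_trans (hR i) hbq (Or.inr hqr'))
      rw [hbr] at hbq
      exact hqr.2 (weak_of_mem_upperFixed (hR i) hbq)
    · have hM' : (R i).raise (D i) r ∈ D i := (hD i).raise_mem (hR i) r
      -- With `p` best and `r` above `q`, the outcome under `S'` cannot be `q`, since `r` is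
      -- available. So it is `p`, which `R i` prefers to its own outcome `q`.
      have hM : ((R i).raise (D i) r).raise (D i) p ∈ D i := (hD i).raise_mem hM' p
      have hqp : q ∉ upperFixed (D i) p := notMem_upperFixed (hR i) hpq
      have h1 := best _ hM p hpB (raise_best _ hM' p hpB)
      have h2 : F (update (update R i (((R i).raise (D i) r).raise (D i) p)) j S') = p := by
        rcases swap _ hM with h2 | h2
        · exact h2.trans h1
        · have h3 := truth _ hM _ hM'
          rw [hr, h2.2] at h3
          exact absurd h3 (raise_strict_of_strict (raise_strict hqr') hqp).2
      have h3 := truth _ (hR i) _ hM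
      rw [h2, hqi] at h3
      exact hpq.2 h3
  · exact noUpper fun b hb hbq =>
      hqp.2 ((R i).trans _ _ _ (hptop b hb) (weak_of_mem_upperFixed (hR i) hbq))

/-- A dictator against one report of agent `j` is a dictator. -/
theorem TruthfulOn.dictator_of_fix [Finite X] (hF : TruthfulOn F D)
    (hD : ∀ i, NonConditional (D i)) {i j : N} {S : Preference X} (hS : S ∈ D j)
    (hB : IsLarge (outcomes F D j S))
    (hi : ∀ R ∈ admissible D, R j = S → ∀ x ∈ outcomes F D j S, (R i).weak (F R) x)
    (hij : i ≠ j) : ∀ R ∈ admissible D, ∀ x ∈ F '' admissible D, (R i).weak (F R) x := by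
  have key : ∀ S' ∈ D j, ∀ R ∈ admissible D, F (update R j S') = F (update R j S) := by
    intro S' hS'
    refine (hD j).swap_induction
      (P := fun T => ∀ R ∈ admissible D, F (update R j T) = F (update R j S))
      ?_ hS hS' fun _ _ => rfl
    intro T hT T' hT' p q h hTS R hR
    rw [← hTS R hR]
    have hout : outcomes F D j T = outcomes F D j S := by
      ext x
      constructor
      · rintro ⟨Q, ⟨hQ, rfl⟩, rfl⟩
        rw [← update_eq_self j Q, hTS Q hQ]
        exact update_mem_outcomes hQ hS
      · rintro ⟨Q, ⟨hQ, rfl⟩, rfl⟩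
        rw [← update_eq_self j Q, ← hTS Q hQ]
        exact update_mem_outcomes hQ hT
    refine hF.eq_of_isSwap_of_dictator hD hT hT' h (i := i) (hout ▸ hB) ?_ hR
    rintro Q hQ rfl x hx
    rw [hout] at hx
    have h1 := hi _ (update_mem_admissible hQ hS) (by simp) x hx
    rwa [update_of_ne hij, ← hTS Q hQ, update_eq_self] at h1
  rintro R hR x ⟨Q, hQ, rfl⟩
  have h1 := key _ (hR j) R hR
  have h2 := key _ (hQ j) Q hQ
  rw [update_eq_self] at h1 h2
  have h3 := hi _ (update_mem_admissible hR hS) (by simp) _ (update_mem_outcomes (F := F) hQ hS)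
  rwa [update_of_ne hij, ← h1, ← h2] at h3

/-! ### Reports that leave at most two outcomes -/

theorem subset_pair_of_not_isLarge {A : Set X} (h : ¬ IsLarge A) : ∃ p q, A ⊆ {p, q} := by
  simp only [IsLarge, not_forall, not_exists, not_and] at h
  obtain ⟨p, q, h⟩ := h
  refine ⟨p, q, fun r hr => ?_⟩
  by_cases hp : r = p
  · exact Or.inl hp
  · exact Or.inr (not_not.1 (h r hr hp))

theorem eq_or_eq_of_not_isLarge {A : Set X} (h : ¬ IsLarge A) {a b c : X} (ha : a ∈ A)
    (hb : b ∈ A) (hc : c ∈ A) (hab : a ≠ b) : c = a ∨ c = b := by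
  obtain ⟨p, q, h⟩ := subset_pair_of_not_isLarge h
  have ha := h ha
  have hb := h hb
  have hc := h hc
  simp only [Set.mem_insert_iff, Set.mem_singleton_iff] at ha hb hc
  grind

/-- A new outcome `q` would make the outcome sets `{p, b}` and `{q, b}`, with the same profiles
leading to `b`. An agent who is pivotal in both could never place `b` between `p` and `q`, but the
domain allows this. -/
theorem TruthfulOn.outcomes_subset_of_isSwap [Finite N] (hF : TruthfulOn F D)
    (hD : ∀ i, NonConditional (D i)) {j : N} {S S' : Preference X} (hS : S ∈ D j)
    (hS' : S' ∈ D j) {p q : X} (h : IsSwap S S' p q) (hB : ¬ IsLarge (outcomes F D j S))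
    (hB' : ¬ IsLarge (outcomes F D j S')) (hne : (outcomes F D j S).Nontrivial) :
    outcomes F D j S' ⊆ outcomes F D j S := by
  rintro v ⟨R, ⟨hR, rfl⟩, rfl⟩
  rcases hF.eq_or_of_isSwap hR hS hS' h with h1 | ⟨h1, h2⟩
  · rw [update_eq_self] at h1
    exact h1 ▸ update_mem_outcomes hR hS
  rw [update_eq_self] at h2
  rw [h2]
  by_contra hq
  have hpB : p ∈ outcomes F D j S := h1 ▸ update_mem_outcomes hR hS
  have hqB : q ∈ outcomes F D j (R j) := ⟨R, ⟨hR, rfl⟩, h2⟩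
  obtain ⟨b, hb, hbp⟩ := hne.exists_ne p
  have hbq : b ≠ q := fun e => hq (e ▸ hb)
  obtain ⟨Rb, ⟨hRb, hRbS⟩, hFb⟩ := hb
  have hb : b ∈ outcomes F D j S := ⟨Rb, ⟨hRb, hRbS⟩, hFb⟩
  have hbB : b ∈ outcomes F D j (R j) := by
    rcases hF.eq_or_of_isSwap hRb hS hS' h with h3 | h3
    · rw [update_eq_of_apply_eq hRbS, hFb] at h3
      exact h3 ▸ update_mem_outcomes hRb hS'
    · rw [update_eq_of_apply_eq hRbS, hFb] at h3
      exact absurd h3.1 hbp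
  have two : ∀ Q ∈ admissible D, F (update Q j S) = p ∧ F (update Q j (R j)) = q ∨
      F (update Q j S) = b ∧ F (update Q j (R j)) = b := by
    intro Q hQ
    have h3 := eq_or_eq_of_not_isLarge hB hpB hb (update_mem_outcomes hQ hS) hbp.symm
    have h4 := eq_or_eq_of_not_isLarge hB' hqB hbB (update_mem_outcomes hQ hS') hbq.symm
    have h5 := hF.eq_or_of_isSwap hQ hS hS' h
    have := h.left.ne
    grind
  -- an agent whose report is pivotal between `p` and `b`, hence also between `q` and `b`
  obtain ⟨Q, hQ, k, hkj, K, hK, hQp, hQb⟩ : ∃ Q ∈ admissible D, ∃ k, k ≠ j ∧ ∃ K ∈ D k,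
      F (update Q j S) = p ∧ F (update (update Q k K) j S) = b := by
    by_contra hno
    refine hbp (hFb.symm.trans ?_)
    have h3 : F (update Rb j S) = p := by
      refine profile_induction (P := fun Q => F (update Q j S) = p) hR hRb h1
        fun Q hQ k _ hQp => ?_
      by_cases hkj : k = j
      · subst hkj
        rwa [update_idem]
      · rcases two _ (update_mem_admissible hQ (hRb k)) with h4 | h4
        · exact h4.1
        · exact absurd ⟨Q, hQ, k, hkj, Rb k, hRb k, hQp, h4.1⟩ hno
    rwa [update_eq_of_apply_eq hRbS] at h3
  have hQq : F (update Q j (R j)) = q :=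
    ((two Q hQ).resolve_right fun h => hbp (h.1.symm.trans hQp)).2
  have hQb' : F (update (update Q k K) j (R j)) = b :=
    ((two _ (update_mem_admissible hQ hK)).resolve_left fun h => hbp (hQb.symm.trans h.1)).2
  have truth : ∀ T ∈ D j, ∀ M ∈ D k, ∀ M' ∈ D k,
      M.weak (F (update (update Q k M) j T)) (F (update (update Q k M') j T)) := by
    intro T hT M hM M' hM'
    rw [update_comm hkj, update_comm hkj]
    exact hF.weak_update (update_mem_admissible hQ hT) hM hM'
  have hQp' : F (update (update Q k (Q k)) j S) = p := by rwa [update_eq_self]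
  have hQq' : F (update (update Q k (Q k)) j (R j)) = q := by rwa [update_eq_self]
  have hpb : (Q k).strict p b := by
    refine strict_of_weak ?_ hbp.symm
    have := truth S hS _ (hQ k) K hK
    rwa [hQb, hQp'] at this
  have hqb : (Q k).strict q b := by
    refine strict_of_weak ?_ hbq.symm
    have := truth _ hS' _ (hQ k) K hK
    rwa [hQb', hQq'] at this
  have hbp' : K.strict b p := by
    refine strict_of_weak ?_ hbp
    have := truth S hS K hK _ (hQ k)
    rwa [hQb, hQp'] at this
  have hbq' : K.strict b q := by
    refine strict_of_weak ?_ hbq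
    have := truth _ hS' K hK _ (hQ k)
    rwa [hQb', hQq'] at this
  -- no admissible preference of the pivotal agent places `b` between `p` and `q`
  have hno : ∀ M ∈ D k, (M.strict p b → ¬ M.strict b q) ∧ (M.strict q b → ¬ M.strict b p) := by
    intro M hM
    have h3 := truth S hS M hM _ (hQ k)
    have h4 := truth S hS M hM _ hK
    have h5 := truth _ hS' M hM _ (hQ k)
    have h6 := truth _ hS' M hM _ hK
    rw [hQp'] at h3
    rw [hQb] at h4
    rw [hQq'] at h5
    rw [hQb'] at h6
    rcases two _ (update_mem_admissible hQ hM) with h7 | h7 <;>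
      rw [h7.1] at h3 h4 <;> rw [h7.2] at h5 h6
    · exact ⟨fun _ h8 => h8.2 h6, fun _ h8 => h8.2 h4⟩
    · exact ⟨fun h8 _ => h8.2 h3, fun h8 _ => h8.2 h5⟩
  have mem : ∀ x, ((Q k).raise (D k) b).raise (D k) x ∈ D k := fun x =>
    (hD k).raise_mem ((hD k).raise_mem (hQ k) b) x
  have hpq : (Q k).strict p q ∨ (Q k).strict q p := (Q k).strict_or_strict h.left.ne
  -- Raising `b`, then whichever of `p` and `q` is preferred by `Q k`, produces the excluded order.
  rcases hpq with hpq | hpq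
  · exact (hno _ (mem p)).1 (raise_strict (notMem_upperFixed (hQ k) hpb))
      (raise_strict_of_strict (raise_strict (notMem_upperFixed hK hbq'))
        (notMem_upperFixed (hQ k) hpq))
  · exact (hno _ (mem q)).2 (raise_strict (notMem_upperFixed (hQ k) hqb))
      (raise_strict_of_strict (raise_strict (notMem_upperFixed hK hbp'))
        (notMem_upperFixed (hQ k) hpq))

/-- If every report of every agent with a choice leaves at most two outcomes, although there are
at least three, then some agent is a dictator. -/
theorem TruthfulOn.dictator_of_small_outcomes [Finite N] [Finite X] (hF : TruthfulOn F D)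
    (hD : ∀ i, NonConditional (D i)) (hne : (admissible D).Nonempty)
    (hA : IsLarge (F '' admissible D))
    (hsmall : ∀ j, (D j).Nontrivial → ∀ S ∈ D j, ¬ IsLarge (outcomes F D j S)) :
    ∃ i, ∀ R ∈ admissible D, ∀ x ∈ F '' admissible D, (R i).weak (F R) x := by
  by_contra hdict
  have mem_out : ∀ {R} {j : N}, R ∈ admissible D → F R ∈ outcomes F D j (R j) :=
    fun hR => ⟨_, ⟨hR, rfl⟩, rfl⟩
  -- Otherwise swaps from one report to all others would confine the whole range to a single small
  -- outcome set.
  have hconst : ∀ j, (D j).Nontrivial → ∃ S ∈ D j, (outcomes F D j S).Subsingleton := by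
    intro j hj
    by_contra! hno
    obtain ⟨S, hS⟩ := hj.nonempty
    refine hsmall j hj S hS fun p q => ?_
    obtain ⟨r, ⟨R, hR, rfl⟩, hr⟩ := hA p q
    refine ⟨F R, ?_, hr⟩
    have hsub : outcomes F D j (R j) ⊆ outcomes F D j S := by
      refine (hD j).swap_induction (P := fun T => outcomes F D j T ⊆ outcomes F D j S)
        ?_ hS (hR j) subset_rfl
      intro T hT T' hT' p q h hsub
      exact (hF.outcomes_subset_of_isSwap hD hT hT' h (hsmall j hj T hT) (hsmall j hj T' hT')
        (by simpa using hno T hT)).trans hsub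
    exact hsub (mem_out hR)
  have hother : ∀ j, ∃ k, k ≠ j ∧ (D k).Nontrivial := by
    intro j
    by_contra! hno
    refine hdict ⟨j, ?_⟩
    rintro R hR x ⟨Q, hQ, rfl⟩
    have h1 : update R j (Q j) = Q := by
      funext k
      by_cases hk : k = j
      · subst hk
        simp
      · rw [update_of_ne hk]
        exact (by simpa using hno k hk : (D k).Subsingleton) (hR k) (hQ k)
    have h2 := hF R hR j _ (hQ j)
    rwa [h1] at h2
  obtain ⟨R₀, hR₀, hconst⟩ : ∃ R₀ ∈ admissible D, ∀ j, (D j).Nontrivial →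
      ∀ R ∈ admissible D, R j = R₀ j → F R = F R₀ := by
    obtain ⟨R', hR'⟩ := hne
    have hex : ∀ j, ∃ S ∈ D j, (D j).Nontrivial → (outcomes F D j S).Subsingleton := by
      intro j
      by_cases hj : (D j).Nontrivial
      · obtain ⟨S, hS, h⟩ := hconst j hj
        exact ⟨S, hS, fun _ => h⟩
      · exact ⟨R' j, hR' j, fun h => absurd h hj⟩
    choose R₀ hR₀ h using hex
    refine ⟨R₀, hR₀, fun j hj R hR hRj => h j hj ⟨R, ⟨hR, hRj⟩, rfl⟩ (mem_out hR₀)⟩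
  set b := F R₀ with hb
  -- Compare truth-telling with deviations to and from `R₀ j`, which enforces `b`.
  have better : ∀ R ∈ admissible D, F R ≠ b → ∀ j, (D j).Nontrivial →
      (R j).strict (F R) b ∧ (R₀ j).strict b (F R) := by
    intro R hR hRb j hj
    have h0 : F (update R j (R₀ j)) = b :=
      hconst j hj _ (update_mem_admissible hR (hR₀ j)) (by simp)
    have h1 := hF R hR j _ (hR₀ j)
    have h2 := hF.weak_update hR (hR₀ j) (hR j)
    rw [h0] at h1 h2
    rw [update_eq_self] at h2
    exact ⟨strict_of_weak h1 hRb, strict_of_weak h2 (Ne.symm hRb)⟩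
  have two : ∀ R ∈ admissible D, F R ≠ b → ∀ R' ∈ admissible D, ∀ j, (D j).Nontrivial →
      R' j = R j → F R' = F R ∨ F R' = b := by
    intro R hR hRb R' hR' j hj hRR'
    obtain ⟨k, hkj, hk⟩ := hother j
    have hbm : b ∈ outcomes F D j (R j) := by
      rw [← hconst k hk (update R₀ j (R j)) (update_mem_admissible hR₀ (hR j)) (by simp [hkj])]
      exact update_mem_outcomes hR₀ (hR j)
    exact eq_or_eq_of_not_isLarge (hsmall j hj _ (hR j)) (mem_out hR) hbm
      ⟨R', ⟨hR', hRR'⟩, rfl⟩ hRb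
  -- at the following profile `b` is below all other attained outcomes
  let U : N → Set X := fun j => {z | ∃ x ∈ F '' admissible D, x ≠ b ∧ z ∈ upperFixed (D j) x}
  let R₁ : N → Preference X := fun j => (R₀ j).lift (U j)
  have hR₁ : R₁ ∈ admissible D := by
    refine fun j => (hD j).lift_mem (hR₀ j) ?_
    rintro x y hxy ⟨z, hz, hzb, hyz⟩
    exact ⟨z, hz, hzb, mem_upperFixed_trans (hR₀ j) hxy hyz⟩
  have hbot : ∀ x ∈ F '' admissible D, x ≠ b → ∀ j, (D j).Nontrivial → (R₁ j).strict x b := by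
    intro x hx hxb j hj
    refine lift_strict_of_mem ⟨x, hx, hxb, Or.inl rfl⟩ ?_
    rintro ⟨z, ⟨R, hR, rfl⟩, hzb, hz⟩
    exact notMem_upperFixed (hR j) (better R hR hzb j hj).1 hz
  obtain ⟨z, hz, hzb, -⟩ := hA b b
  have hR₁b : F R₁ ≠ b := hF.pareto hD hR₁ hz hzb (hbot z hz hzb)
  obtain ⟨-, ⟨R, hR, rfl⟩, hRx, hRb⟩ := hA (F R₁) b
  refine hF.pareto hD hR ⟨R₁, hR₁, rfl⟩ (Ne.symm hRx) (fun j hj => ?_) rfl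
  -- Otherwise `j` could rank `F R` above `b` above `F R₁`. Efficiency excludes `b`, and `two`,
  -- applied to another agent `k`, leaves only `F R₁`, which contradicts `better`.
  have hfix : F R₁ ∈ upperFixed (D j) (F R) := by
    by_contra hnot
    have hM : ((R₁ j).raise (D j) b).raise (D j) (F R) ∈ D j :=
      (hD j).raise_mem ((hD j).raise_mem (hR₁ j) b) _
    have hadm := update_mem_admissible hR₁ hM
    obtain ⟨k, hkj, hk⟩ := hother j
    have hnb : F (update R₁ j (((R₁ j).raise (D j) b).raise (D j) (F R))) ≠ b := by
      refine hF.pareto hD hadm ⟨R, hR, rfl⟩ hRb fun l hl => ?_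
      by_cases hlj : l = j
      · subst hlj
        rw [update_self]
        exact raise_strict (notMem_upperFixed (hR l) (better R hR hRb l hl).1)
      · rw [update_of_ne hlj]
        exact hbot _ ⟨R, hR, rfl⟩ hRb l hl
    have h1 := (two R₁ hR₁ hR₁b _ hadm k hk (by simp [hkj])).resolve_right hnb
    have h2 := (better _ hadm hnb j hj).1
    rw [h1, update_self] at h2
    exact h2.2 (raise_strict_of_strict
      (raise_strict (notMem_upperFixed (hR₀ j) (better R₁ hR₁ hR₁b j hj).2)) hnot).1
  exact strict_of_weak (weak_of_mem_upperFixed (hR j) hfix) (Ne.symm hRx)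

/-- The induction runs over the number of agents whose domain is nontrivial; the set of agents never
changes. -/
theorem TruthfulOn.exists_dictator [Finite N] [Finite X] (hF : TruthfulOn F D)
    (hD : ∀ i, NonConditional (D i)) (hne : (admissible D).Nonempty)
    (hA : IsLarge (F '' admissible D)) :
    ∃ i, ∀ R ∈ admissible D, ∀ x ∈ F '' admissible D, (R i).weak (F R) x := by
  induction hn : {j | (D j).Nontrivial}.ncard using Nat.strong_induction_on generalizing D with
  | _ n ih =>
    by_cases hsmall : ∀ j, (D j).Nontrivial → ∀ S ∈ D j, ¬ IsLarge (outcomes F D j S)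
    · exact hF.dictator_of_small_outcomes hD hne hA hsmall
    push Not at hsmall
    obtain ⟨j, hj, S, hS, hB⟩ := hsmall
    have himage : F '' admissible (update D j {S}) = outcomes F D j S := by
      simp only [outcomes, ← admissible_fix hS]
      rfl
    have hlt : {k | (update D j {S} k).Nontrivial}.ncard < n := by
      rw [← hn]
      refine Set.ncard_lt_ncard (Set.ssubset_iff_of_subset ?_ |>.2 ⟨j, hj, by simp⟩)
        (Set.toFinite _)
      intro k hk
      by_cases hkj : k = j
      · subst hkj
        simp at hk
      · simpa [hkj] using hk
    have hne' : (admissible (update D j {S})).Nonempty := by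
      obtain ⟨R, hR⟩ := hne
      exact ⟨_, (admissible_fix hS).2 ⟨update_mem_admissible hR hS, update_self _ _ _⟩⟩
    obtain ⟨i, hi⟩ := ih _ hlt (hF.fix hS) (fun k => by
      by_cases hkj : k = j
      · subst hkj
        simpa using NonConditional.singleton S
      · simpa [hkj] using hD k) hne' (himage ▸ hB) rfl
    rw [himage] at hi
    refine ⟨i, hF.dictator_of_fix hD hS hB
      (fun R hR hRS => hi R ((admissible_fix hS).2 ⟨hR, hRS⟩)) ?_⟩
    rintro rfl
    obtain ⟨a, ⟨Ra, hRa, rfl⟩, -, -⟩ := hB (F fun _ => S) (F fun _ => S)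
    obtain ⟨b, ⟨Rb, hRb, rfl⟩, hb, -⟩ := hB (F Ra) (F Ra)
    have h1 := hi Ra ((admissible_fix hS).2 hRa) _ ⟨Rb, hRb, rfl⟩
    have h2 := hi Rb ((admissible_fix hS).2 hRb) _ ⟨Ra, hRa, rfl⟩
    rw [hRa.2] at h1
    rw [hRb.2] at h2
    exact hb (S.antisymm _ _ h2 h1)

end Rules

theorem theorem1 {N X : Type*} [Finite N] [Nonempty N] [DecidableEq N] [Finite X]
    (D : N → Set (Preference X)) (hD : ∀ i, NonConditional (D i)) :
    ¬ ∃ f : SocialChoiceRule D, f.range.ncard ≠ 2 ∧ f.StrategyProof ∧ f.NonDictatorial := by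
  classical
  rintro ⟨f, hcard, hsp, hnd⟩
  apply hnd
  by_cases hA : IsLarge f.range
  · cases isEmpty_or_nonempty (Profile D) with
    -- Some domain may be empty; dictatorship is then vacuous.
    | inl h => exact ⟨Classical.arbitrary N, fun R => h.elim R⟩
    | inr h =>
      obtain ⟨P₀⟩ := h
      -- The value `f P₀` at inadmissible profiles is irrelevant.
      let F : (N → Preference X) → X := fun R =>
        if h : ∀ i, R i ∈ D i then f fun i => ⟨R i, h i⟩ else f P₀
      have hFf : ∀ P : Profile D, F (fun i => (P i).1) = f P := fun P =>
        dif_pos fun i => (P i).2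
      have himage : F '' admissible D = f.range := by
        ext x
        constructor
        · rintro ⟨R, hR, rfl⟩
          exact ⟨fun i => ⟨R i, hR i⟩, (hFf _).symm⟩
        · rintro ⟨P, rfl⟩
          exact ⟨_, fun i => (P i).2, hFf P⟩
      have hF : TruthfulOn F D := by
        intro R hR i Q hQ
        have h1 := hFf fun i => ⟨R i, hR i⟩
        have h2 := hFf (update (fun i => ⟨R i, hR i⟩) i ⟨Q, hQ⟩)
        have h3 : (fun k => (update (fun i => (⟨R i, hR i⟩ : D i)) i ⟨Q, hQ⟩ k).1) =
            update R i Q := by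
          funext k
          by_cases hk : k = i
          · subst hk
            simp
          · simp [hk]
        rw [h3] at h2
        rw [h1, h2]
        exact Preference.weak_of_not_strict fun hs => hsp i ⟨fun i => ⟨R i, hR i⟩, ⟨Q, hQ⟩, hs⟩
      obtain ⟨i, hi⟩ := hF.exists_dictator hD ⟨_, fun i => (P₀ i).2⟩ (himage ▸ hA)
      refine ⟨i, fun P x hx => ?_⟩
      have := hi (fun i => (P i).1) (fun i => (P i).2) x (himage ▸ hx)
      rwa [hFf] at this
  · refine ⟨Classical.arbitrary N, fun R x hx => ?_⟩
    obtain ⟨p, q, hpq⟩ := subset_pair_of_not_isLarge hA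
    have hle : f.range.ncard ≤ 1 := by
      have := (Set.ncard_le_ncard hpq (Set.toFinite _)).trans (Set.ncard_insert_le p {q})
      rw [Set.ncard_singleton] at this
      omega
    rw [Set.ncard_le_one (Set.toFinite _)] at hle
    rw [hle x hx (f R) ⟨R, rfl⟩]
    exact Preference.weak_refl _ _
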